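/- Let $Z$ be a standard normal random variable, that is, $\mathbb{P}(Z \le x) = \int_{-\infty}^x \frac{e^{-t^2/2}}{\sqrt{2\pi}}\,dt$ for all $x \in \mathbb{R}$. If $X_1, X_2, \ldots$ are independent and identically distributed real random variables satisfying $\mathbb{E}[X_1] = 0$ and $\mathbb{E}[X_1^2] = 1$, then $(X_1 + \cdots + X_n)/\sqrt{n}$ converges in distribution to $Z$, that is, $$\lim_{n\to\infty} \mathbb{P}\left(\frac{X_1+\cdots+X_n}{\sqrt{n}} \le x\right) = \mathbb{P}(Z \le x) \qquad \text{for all } x \in \mathbb{R}.$$ -/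

import Mathlib

open MeasureTheory ProbabilityTheory Filter Topology

/-- `Z` is a standard normal random variable on the probability space `(Ω, P)`:
`P(Z ≤ x) = ∫_{-∞}^x e^{-t²/2} / √(2π) dt` for all real `x`. -/
def IsStandardNormal {Ω : Type*} [MeasurableSpace Ω] (P : Measure Ω) (Z : Ω → ℝ) : Prop :=
  AEMeasurable Z P ∧
    ∀ x : ℝ, P.real {ω | Z ω ≤ x} =
      ∫ t in Set.Iic x, Real.exp (-t ^ 2 / 2) / Real.sqrt (2 * Real.pi)

/-- Convergence in distribution `S n ⇒ W` of real random variables on `(Ω, P)` to a random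
variable `W` on `(Ω', P')` with a continuous distribution function (such as a normal one):
`P(S n ≤ x) → P'(W ≤ x)` for all real `x`. -/
def ConvergesInDistribution {Ω Ω' : Type*} [MeasurableSpace Ω] [MeasurableSpace Ω']
    (P : Measure Ω) (S : ℕ → Ω → ℝ) (P' : Measure Ω') (W : Ω' → ℝ) : Prop :=
  ∀ x : ℝ, Tendsto (fun n : ℕ => P.real {ω | S n ω ≤ x}) atTop (𝓝 (P'.real {ω | W ω ≤ x}))

/-! Mathlib's central limit theorem `tendstoInDistribution_inv_sqrt_mul_sum` gives weak convergence
to the Gaussian law. That law has no atoms, so the portmanteau theorem applied to half-lines gives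
convergence of distribution functions. -/

theorem gaussianReal_zero_one_real_Iic (x : ℝ) :
    (gaussianReal 0 1).real (Set.Iic x) =
      ∫ t in Set.Iic x, Real.exp (-t ^ 2 / 2) / Real.sqrt (2 * Real.pi) := by
  rw [measureReal_def, gaussianReal_apply_eq_integral 0 one_ne_zero,
    ENNReal.toReal_ofReal (integral_nonneg fun t => gaussianPDFReal_nonneg 0 1 t)]
  refine integral_congr_ae (ae_of_all _ fun t => ?_)
  simp [gaussianPDFReal, div_eq_inv_mul]

/-- A standard normal random variable has the standard Gaussian measure as its law. -/
theorem IsStandardNormal.hasLaw {Ω : Type*} [MeasurableSpace Ω] {P : Measure Ω}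
    [IsProbabilityMeasure P] {Z : Ω → ℝ} (hZ : IsStandardNormal P Z) :
    HasLaw Z (gaussianReal 0 1) P where
  aemeasurable := hZ.1
  map_eq := by
    refine Measure.ext_of_Iic _ _ fun x => ?_
    have := Measure.isProbabilityMeasure_map hZ.1
    rw [← measureReal_eq_measureReal_iff, gaussianReal_zero_one_real_Iic,
      map_measureReal_apply_of_aemeasurable hZ.1 measurableSet_Iic]
    exact hZ.2 x

/-- Convergence in distribution implies convergence of the distribution functions, provided that
the limit law has no atoms. -/
theorem MeasureTheory.TendstoInDistribution.convergesInDistribution {Ω Ω' : Type*}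
    [MeasurableSpace Ω] [MeasurableSpace Ω'] {P : Measure Ω} [IsProbabilityMeasure P]
    {P' : Measure Ω'} [IsProbabilityMeasure P'] {S : ℕ → Ω → ℝ} {W : Ω' → ℝ}
    (h : TendstoInDistribution S atTop W (fun _ => P) P') (hW : ∀ x : ℝ, P'.map W {x} = 0) :
    ConvergesInDistribution P S P' W := by
  intro x
  -- The frontier of `Set.Iic x` is `{x}`, which is null by `hW`.
  have key := ProbabilityMeasure.tendsto_measure_of_null_frontier_of_tendsto' h.tendsto
    (E := Set.Iic x) (by simpa [frontier_Iic] using hW x)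
  simp only [ProbabilityMeasure.coe_mk,
    Measure.map_apply_of_aemeasurable h.aemeasurable_limit measurableSet_Iic,
    fun n => Measure.map_apply_of_aemeasurable (h.forall_aemeasurable n)
      (measurableSet_Iic (a := x))] at key
  exact (ENNReal.tendsto_toReal (measure_ne_top _ _)).comp key

/-- Central limit theorem. The `n`-th variable `X_n` of the sequence (`n ≥ 1`) is `X (n - 1)`.
The condition on the second moment forces `X 0 ^ 2`, hence `X 0`, to be integrable. -/
theorem theorem2 {Ω Ω' : Type*} [MeasurableSpace Ω] [MeasurableSpace Ω']
    (P : Measure Ω) [IsProbabilityMeasure P] (P' : Measure Ω') [IsProbabilityMeasure P']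
    (X : ℕ → Ω → ℝ) (Z : Ω' → ℝ)
    (hindep : iIndepFun X P)
    (hident : ∀ i : ℕ, IdentDistrib (X i) (X 0) P P)
    (hmean : ∫ ω, X 0 ω ∂P = 0)
    (hvar : ∫ ω, (X 0 ω) ^ 2 ∂P = 1)
    (hZ : IsStandardNormal P' Z) :
    ConvergesInDistribution P
      (fun (n : ℕ) (ω : Ω) => (∑ i ∈ Finset.range n, X i ω) / Real.sqrt (n : ℝ)) P' Z := by
  have hvar' : ∫ ω, (X 0 ^ 2) ω ∂P = 1 := by simpa using hvar
  have hclt := tendstoInDistribution_inv_sqrt_mul_sum hZ.hasLaw hmean hvar' hindep hident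
  simp_rw [← div_eq_inv_mul] at hclt
  refine hclt.convergesInDistribution fun x => ?_
  -- Nonzero variance rules out atoms.
  have := nullSingletonClass_gaussianReal (μ := 0) (v := 1) one_ne_zero
  rw [hZ.hasLaw.map_eq, measure_singleton]
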